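/- All graphs are finite and simple. The Laplacian spectrum of a graph $G$ on $n$ vertices is the multiset $\mu_1\ge\dots\ge\mu_n$ of eigenvalues of $L=D-A$ ($D$ the diagonal matrix of vertex degrees, $A$ the adjacency matrix), its Laplacian energy is $LE(G)=\sum_{i=1}^n|\mu_i-\bar d|$ with $\bar d$ the average degree of $G$, and two graphs are noncospectral if their Laplacian spectra differ. A graph is unicyclic if it is connected and contains exactly one cycle. Let $\ell\ge 2$ and $\gamma\ge 1$ be integers. There exists a family of $\ell$ pairwise noncospectral unicyclic graphs, each on $n=2\ell^2+2\ell+2\gamma$ vertices, all with the same Laplacian energy. Moreover, if $\gamma\ge 2$, there are at least two such families that are different in the sense that no graph of one is isomorphic to a graph of the other. In particular (the case $\gamma=1$), for the values of $n$ of the form $n=2\ell^2+2\ell+2$ with $\ell\ge2$ there is a family of $\Theta(\sqrt n)$ pairwise noncospectral unicyclic graphs on $n$ vertices with the same Laplacian energy. -/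

import Mathlib

/-- The Laplacian spectrum of a finite graph: the multiset of eigenvalues (with multiplicity) of its
Laplacian matrix `D - A`, as the multiset of real roots of the characteristic polynomial. -/
noncomputable def SimpleGraph.lapSpectrum {V : Type*} [Fintype V] [DecidableEq V]
    (G : SimpleGraph V) : Multiset ℝ :=
  open Classical in (G.lapMatrix ℝ).charpoly.roots

/-- No eigenvalue is lost: the Laplacian spectrum of an `n`-vertex graph has `n` elements. -/
theorem SimpleGraph.card_lapSpectrum {V : Type*} [Fintype V] [DecidableEq V]
    (G : SimpleGraph V) : G.lapSpectrum.card = Fintype.card V := by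
  classical
  have h : (G.lapMatrix ℝ).IsHermitian := by
    have := G.isSymm_lapMatrix (R := ℝ)
    rw [Matrix.IsHermitian, Matrix.conjTranspose_eq_transpose_of_trivial]
    exact this
  unfold SimpleGraph.lapSpectrum
  have h2 := h.roots_charpoly_eq_eigenvalues
  convert congrArg Multiset.card h2 using 1
  simp

/-- The average degree of a finite graph. -/
noncomputable def SimpleGraph.avgDegree {V : Type*} [Fintype V] (G : SimpleGraph V) : ℝ :=
  open Classical in (∑ v, (G.degree v : ℝ)) / Fintype.card V

/-- The Laplacian energy: the sum of `|μ - d|` over the Laplacian eigenvalues `μ`, where `d` is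
the average degree. -/
noncomputable def SimpleGraph.laplacianEnergy {V : Type*} [Fintype V] [DecidableEq V]
    (G : SimpleGraph V) : ℝ :=
  (G.lapSpectrum.map fun μ => |μ - G.avgDegree|).sum

/-- A graph is unicyclic if it is connected and has exactly one cycle (as a subgraph). -/
def SimpleGraph.IsUnicyclic {V : Type*} (G : SimpleGraph V) : Prop :=
  G.Connected ∧ ∃! C : G.Subgraph, ∃ (v : V) (p : G.Walk v v), p.IsCycle ∧ p.toSubgraph = C

/-- A family of `m` unicyclic graphs on `n` vertices that are pairwise (Laplacian-)noncospectral
and all have the same Laplacian energy. -/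
def IsEquienergeticUnicyclicFamily {m n : ℕ} (G : Fin m → SimpleGraph (Fin n)) : Prop :=
  (∀ i, (G i).IsUnicyclic) ∧
  (∀ i j, i ≠ j → (G i).lapSpectrum ≠ (G j).lapSpectrum) ∧
  (∀ i j, (G i).laplacianEnergy = (G j).laplacianEnergy)

/-! Take a tree `T` in which two pendant paths with `m` vertices hang at the vertex `0`, and join
their far ends. The new graph is unicyclic with average degree 2. The added edge perturbs the
Laplacian by a rank-one matrix that acts only on vectors antisymmetric under the swap of the two
legs. On these the eigenvalue equation is that of a path, and the effect is to replace the roots of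
`pathPoly (m + 1) - pathPoly m` in the spectrum of `T` by those of `pathPoly (m + 1) + pathPoly m`
(`charpoly_closure`).

The substitution `x ↦ 4 - x` exchanges these two sets of roots, so distances to 2, the average
degree, are preserved (`pathPoly_sum_abs`). Hence the energy is the sum of `|μ - 2|` over the
spectrum of `T`, whichever pair of legs is joined (`laplacianEnergy_closure`). Values at 0 show that
different `m` give different spectra (`lapSpectrum_closure_ne`).

One spider with legs `1, 1, 2, 2, …, ℓ, ℓ` thus yields `ℓ` graphs; the remaining vertices are leaves
at the centre. Rehanging one leaf lowers the degree of the centre and gives the second family. -/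

open Polynomial

/-! ### Path polynomials and their symmetry about 2 -/

/-- The polynomials with `s 0 = 0`, `s 1 = 1`, `s (k + 2) = (2 - X) * s (k + 1) - s k`: they are the
entries of the solutions of the eigenvalue equation of the Laplacian along a path. -/
noncomputable def pathPoly : ℕ → ℝ[X]
  | 0 => 0
  | 1 => 1
  | k + 2 => (C 2 - X) * pathPoly (k + 1) - pathPoly k

/-- The reflection negates the factor `2 - X` of the recursion, so each polynomial is even or odd
about 2. -/
theorem pathPoly_comp (k : ℕ) :
    (pathPoly k).comp (C 4 - X) = (-1) ^ (k + 1) * pathPoly k := by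
  induction k using Nat.twoStepInduction with
  | zero => simp [pathPoly]
  | one => simp [pathPoly]
  | more k h₁ h₂ =>
    have h4 : (C 2 - (C 4 - X) : ℝ[X]) = -(C 2 - X) := by
      rw [show (4 : ℝ) = 2 + 2 by norm_num, C_add]
      ring
    rw [pathPoly, sub_comp, mul_comp, h₁, h₂, sub_comp, X_comp, C_comp, h4]
    ring

theorem pathPoly_eval_zero (k : ℕ) : (pathPoly k).eval 0 = k := by
  induction k using Nat.twoStepInduction with
  | zero => simp [pathPoly]
  | one => simp [pathPoly]
  | more k h₁ h₂ =>
    rw [pathPoly, eval_sub, eval_mul, h₁, h₂, eval_sub, eval_C, eval_X]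
    push_cast
    ring

theorem pathPoly_succ_sub_eval_zero (m : ℕ) : (pathPoly (m + 1) - pathPoly m).eval 0 = 1 := by
  simp [pathPoly_eval_zero]

theorem pathPoly_succ_add_eval_zero (m : ℕ) :
    (pathPoly (m + 1) + pathPoly m).eval 0 = 2 * m + 1 := by
  simp [pathPoly_eval_zero]
  ring

theorem pathPoly_succ_sub_ne_zero (m : ℕ) : pathPoly (m + 1) - pathPoly m ≠ 0 := fun h => by
  simpa [h] using pathPoly_succ_sub_eval_zero m

theorem pathPoly_succ_add_ne_zero (m : ℕ) : pathPoly (m + 1) + pathPoly m ≠ 0 := fun h => by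
  have := pathPoly_succ_add_eval_zero m
  rw [h, eval_zero] at this
  have : (0 : ℝ) ≤ m := m.cast_nonneg
  linarith

theorem pathPoly_sub_roots (m : ℕ) :
    (pathPoly (m + 1) - pathPoly m).roots.map (fun x => 4 - x) =
      (pathPoly (m + 1) + pathPoly m).roots := by
  have h := map_roots_comp_C_mul_X_add_C (pathPoly (m + 1) + pathPoly m) (-1) 4 isUnit_one.neg
  have h4 : (C (-1) * X + C 4 : ℝ[X]) = C 4 - X := by rw [C_neg, C_1]; ring
  rw [h4, add_comp, pathPoly_comp, pathPoly_comp] at h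
  have h5 : ((-1) ^ (m + 1 + 1) * pathPoly (m + 1) + (-1) ^ (m + 1) * pathPoly m : ℝ[X]) =
      C ((-1) ^ m) * (pathPoly (m + 1) - pathPoly m) := by
    simp only [map_pow, map_neg, map_one]
    ring
  rw [h5, roots_C_mul _ (by simp)] at h
  rw [← h]
  congr 1
  ext x
  ring

/-- The roots of `pathPoly (m + 1) + pathPoly m` are the reflections about `2` of the roots of
`pathPoly (m + 1) - pathPoly m`, so that both are equally far from `2` in total. -/
theorem pathPoly_sum_abs (m : ℕ) :
    ((pathPoly (m + 1) + pathPoly m).roots.map fun x => |x - 2|).sum =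
      ((pathPoly (m + 1) - pathPoly m).roots.map fun x => |x - 2|).sum := by
  rw [← pathPoly_sub_roots, Multiset.map_map]
  congr 2
  ext x
  simp only [Function.comp]
  rw [← abs_neg]
  ring_nf

/-! ### Rank-one updates of determinants -/

/-- A form of the matrix determinant lemma without division. -/
theorem Matrix.mul_det_sub_vecMulVec {n R : Type*} [Fintype n] [DecidableEq n] [CommRing R]
    (A : Matrix n n R) (w z : n → R) (d : R) (h : A.mulVec z = d • w) :
    d * (A - Matrix.vecMulVec w w).det = A.det * (d - w ⬝ᵥ z) := by
  -- The Schur complement of the corner `1` in `B` is the updated matrix. Multiplying by `Z` clears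
  -- the last column above the corner, because `z` solves the system with right-hand side `d • w`.
  let B : Matrix (n ⊕ Unit) (n ⊕ Unit) R :=
    Matrix.fromBlocks A (Matrix.replicateCol Unit w) (Matrix.replicateRow Unit w) 1
  let Z : Matrix (n ⊕ Unit) (n ⊕ Unit) R :=
    Matrix.fromBlocks 1 (-Matrix.replicateCol Unit z) 0 (Matrix.of fun _ _ => d)
  have hB : B.det = (A - Matrix.vecMulVec w w).det := by
    rw [Matrix.det_fromBlocks_one₂₂]
    congr 2
    ext i j
    simp [Matrix.mul_apply, Matrix.vecMulVec_apply]
  have hZ : Z.det = d := by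
    rw [Matrix.det_fromBlocks_zero₂₁]
    simp
  have hBZ : B * Z = Matrix.fromBlocks A 0 (Matrix.replicateRow Unit w)
      (Matrix.of fun _ _ => d - w ⬝ᵥ z) := by
    rw [Matrix.fromBlocks_multiply]
    congr 1
    · simp
    · ext i j
      have := congrFun h i
      simp only [Matrix.mulVec, Pi.smul_apply, smul_eq_mul, dotProduct] at this
      simp [Matrix.mul_apply, this]
      ring
    · simp
    · ext i j
      simp [Matrix.mul_apply, dotProduct]
      ring
  have := congrArg Matrix.det hBZ
  rw [Matrix.det_mul, hB, hZ, Matrix.det_fromBlocks_zero₁₂] at this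
  rw [mul_comm, this]
  simp

/-! ### Adding an edge to a tree -/

namespace SimpleGraph

/-- A tree with one extra edge is unicyclic. -/
theorem IsTree.isUnicyclic_sup_edge {V : Type*} {T : SimpleGraph V} (hT : T.IsTree) {x y : V}
    (hne : x ≠ y) (hxy : ¬ T.Adj x y) : (T ⊔ edge x y).IsUnicyclic := by
  classical
  set G := T ⊔ edge x y with hG
  have hle : T ≤ G := le_sup_left
  have hadj : G.Adj x y := by simp [hG, edge_adj, hne]
  have hT' : ∀ e ∈ G.edgeSet, e ≠ s(x, y) → e ∈ T.edgeSet := by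
    intro e
    induction e with | _ a b
    simp only [hG, mem_edgeSet, sup_adj, edge_adj]
    rintro (h | h) hn
    · exact h
    · exact absurd (by aesop) hn
  refine ⟨hT.connected.mono hle, ?_⟩
  obtain ⟨P, hP, -⟩ := hT.existsUnique_path y x
  have hPe : s(x, y) ∉ P.edges := fun h => hxy (P.edges_subset_edgeSet h)
  refine ⟨(Walk.cons hadj (P.mapLe hle)).toSubgraph, ⟨x, Walk.cons hadj (P.mapLe hle), ?_, rfl⟩, ?_⟩
  · rw [Walk.cons_isCycle_iff]
    refine ⟨hP.mapLe hle, by simpa using hPe⟩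
  · rintro C ⟨v, p, hp, rfl⟩
    -- A cycle avoiding the new edge would be a cycle of `T`.
    have he : s(x, y) ∈ p.edges := by
      by_contra he
      exact hT.isAcyclic _ (hp.transfer (H := T) fun e h =>
        hT' e (p.edges_subset_edgeSet h) fun h' => he (h' ▸ h))
    have hx : x ∈ p.support := p.fst_mem_support_of_mem_edges he
    -- Rotate the cycle to start at `x` and reverse it if necessary, so that its first step is the
    -- new edge; the rest is then the unique path of `T` from `y` to `x`.
    obtain ⟨q, hq, hsnd, hqp⟩ : ∃ q : G.Walk x x, q.IsCycle ∧ q.snd = y ∧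
        q.toSubgraph = p.toSubgraph := by
      have hr := hp.rotate hx
      have hrs : (p.rotate x hx).toSubgraph = p.toSubgraph := p.toSubgraph_rotate hx
      have hy : y ∈ (p.rotate x hx).toSubgraph.neighborSet x := by
        rw [hrs]
        exact Walk.adj_toSubgraph_iff_mem_edges.2 he
      rw [hr.neighborSet_toSubgraph_endpoint] at hy
      rcases hy with h | h
      · exact ⟨_, hr, h.symm, hrs⟩
      · refine ⟨_, hr.reverse, ?_, by rw [Walk.toSubgraph_reverse, hrs]⟩
        rw [Walk.snd_reverse]
        exact h.symm
    rw [← hqp]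
    cases q with
    | nil => exact absurd hq Walk.not_isCycle_nil
    | cons h r =>
      obtain rfl : _ = y := by simpa using hsnd
      rw [Walk.cons_isCycle_iff] at hq
      have hrT : ∀ e ∈ r.edges, e ∈ T.edgeSet := fun e h =>
        hT' e (r.edges_subset_edgeSet h) fun h' => hq.2 (h' ▸ h)
      have : r.transfer T hrT = P :=
        congrArg Subtype.val
          ((hT.isAcyclic.subsingleton_path _ _).elim ⟨_, hq.1.transfer hrT⟩ ⟨P, hP⟩)
      have hr : r = P.mapLe hle := by
        have hrG : ∀ e ∈ (r.transfer T hrT).edges, e ∈ G.edgeSet := by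
          simpa using r.edges_subset_edgeSet
        rw [← this, Walk.mapLe, ← Walk.transfer_eq_map_ofLE _ hrG, Walk.transfer_transfer,
          Walk.transfer_self]
      rw [hr]

/-! ### The Laplacian after adding an edge -/

variable {V : Type*} [Fintype V] [DecidableEq V]

theorem lapMatrix_mulVec_eq_sum {R : Type*} [CommRing R] (G : SimpleGraph V) [DecidableRel G.Adj]
    (x : V → R) (v : V) :
    (G.lapMatrix R).mulVec x v = ∑ u, if G.Adj v u then x v - x u else 0 := by
  rw [lapMatrix_mulVec_apply, degree_eq_sum_if_adj, Finset.sum_mul, neighborFinset_eq_filter,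
    Finset.sum_filter, ← Finset.sum_sub_distrib]
  refine Finset.sum_congr rfl fun u _ => ?_
  split_ifs <;> simp

theorem lapMatrix_sup_edge {R : Type*} [CommRing R] (T : SimpleGraph V) [DecidableRel T.Adj]
    {a b : V} [DecidableRel (T ⊔ edge a b).Adj] (hne : a ≠ b) (hab : ¬ T.Adj a b) :
    (T ⊔ edge a b).lapMatrix R = T.lapMatrix R +
      Matrix.vecMulVec (Pi.single a 1 - Pi.single b 1) (Pi.single a 1 - Pi.single b 1) := by
  refine Matrix.ext_of_mulVec_single fun j => ?_
  ext i
  have key : ∀ x : V → R, ((T ⊔ edge a b).lapMatrix R).mulVec x i = (T.lapMatrix R).mulVec x i +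
      ((if i = a then x a - x b else 0) + if i = b then x b - x a else 0) := by
    intro x
    have h1 : (if i = a then x a - x b else 0) =
        ∑ u, if u = b then (if i = a then x i - x u else 0) else 0 := by
      rw [Finset.sum_ite_eq' Finset.univ b, if_pos (Finset.mem_univ b)]
      split_ifs with h <;> simp [*]
    have h2 : (if i = b then x b - x a else 0) =
        ∑ u, if u = a then (if i = b then x i - x u else 0) else 0 := by
      rw [Finset.sum_ite_eq' Finset.univ a, if_pos (Finset.mem_univ a)]
      split_ifs with h <;> simp [*]
    rw [lapMatrix_mulVec_eq_sum, lapMatrix_mulVec_eq_sum, h1, h2, ← Finset.sum_add_distrib,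
      ← Finset.sum_add_distrib]
    refine Finset.sum_congr rfl fun u _ => ?_
    have hba : ¬ T.Adj b a := fun h => hab h.symm
    simp only [sup_adj, edge_adj]
    by_cases hia : i = a <;> by_cases hib : i = b <;> by_cases hua : u = a <;>
      by_cases hub : u = b <;> simp_all
  rw [key, Matrix.add_mulVec, Pi.add_apply, Matrix.vecMulVec_mulVec]
  congr 1
  simp only [Pi.smul_apply, Pi.sub_apply, Pi.single_apply, dotProduct, MulOpposite.smul_eq_mul_unop]
  simp only [sub_mul, ite_mul, one_mul, zero_mul, mul_ite, mul_one, mul_zero,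
    Finset.sum_ite_eq', Finset.mem_univ, if_true, MulOpposite.unop_op]
  grind

theorem charmatrix_lapMatrix_mulVec (G : SimpleGraph V) [DecidableRel G.Adj] (z : V → ℝ[X]) (v : V) :
    (G.lapMatrix ℝ).charmatrix.mulVec z v =
      X * z v - (G.lapMatrix ℝ[X]).mulVec z v := by
  have : (C : ℝ →+* ℝ[X]).mapMatrix (G.lapMatrix ℝ) = G.lapMatrix ℝ[X] := by
    ext i j
    simp only [lapMatrix, degMatrix, RingHom.mapMatrix_apply, Matrix.map_apply, Matrix.sub_apply,
      Matrix.diagonal_apply, adjMatrix_apply]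
    split_ifs <;> simp
  rw [Matrix.charmatrix, this, Matrix.sub_mulVec, Pi.sub_apply]
  simp [Matrix.scalar_apply, Matrix.mulVec_diagonal]

/-- If adding an edge `a b` acts on an explicit solution `z` of `(X - L) z = d (e_a - e_b)`, the
characteristic polynomials before and after are related. -/
theorem mul_charpoly_lapMatrix_sup_edge (T : SimpleGraph V) [DecidableRel T.Adj]
    {a b : V} [DecidableRel (T ⊔ edge a b).Adj] (hne : a ≠ b) (hab : ¬ T.Adj a b)
    (z : V → ℝ[X]) (d : ℝ[X])
    (hz : ∀ v, X * z v - (T.lapMatrix ℝ[X]).mulVec z v =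
      d * ((if v = a then 1 else 0) - if v = b then 1 else 0)) :
    d * ((T ⊔ edge a b).lapMatrix ℝ).charpoly =
      (T.lapMatrix ℝ).charpoly * (d - (z a - z b)) := by
  have h := Matrix.mul_det_sub_vecMulVec (T.lapMatrix ℝ).charmatrix
    (Pi.single a 1 - Pi.single b 1) z d (by
      ext1 v
      rw [charmatrix_lapMatrix_mulVec, hz]
      simp [Pi.single_apply])
  rw [sub_dotProduct, single_one_dotProduct, single_one_dotProduct] at h
  rw [Matrix.charpoly, Matrix.charpoly, ← h, lapMatrix_sup_edge T hne hab]
  congr 2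
  ext i j
  simp only [Matrix.charmatrix, RingHom.mapMatrix_apply, Matrix.map_apply, Matrix.sub_apply,
    Matrix.add_apply, Matrix.vecMulVec_apply, Pi.sub_apply, Pi.single_apply]
  split_ifs <;> simp <;> ring

/-! ### Spiders -/

open Classical in
/-- The parent of the vertex `v` in `spider n S`. -/
noncomputable def spiderParent (S : Set ℕ) (v : ℕ) : ℕ := if v ∈ S then v - 1 else 0

theorem spiderParent_of_mem {S : Set ℕ} {v : ℕ} (h : v ∈ S) : spiderParent S v = v - 1 := if_pos h

theorem spiderParent_of_notMem {S : Set ℕ} {v : ℕ} (h : v ∉ S) : spiderParent S v = 0 := if_neg h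

theorem spiderParent_lt (S : Set ℕ) {v : ℕ} (h : v ≠ 0) : spiderParent S v < v := by
  unfold spiderParent
  split_ifs <;> omega

/-- The tree on `0, …, n - 1` in which the vertices `v ∈ S` are attached to `v - 1` and all others
to `0`. -/
def spider (n : ℕ) (S : Set ℕ) : SimpleGraph (Fin n) where
  Adj a b := a ≠ b ∧ (spiderParent S a = b ∨ spiderParent S b = a)
  symm := ⟨fun _ _ h => ⟨h.1.symm, h.2.symm⟩⟩
  loopless := ⟨fun _ h => h.1 rfl⟩

theorem spider_adj {n : ℕ} {S : Set ℕ} {a b : Fin n} :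
    (spider n S).Adj a b ↔ a ≠ b ∧ (spiderParent S a = b ∨ spiderParent S b = a) := Iff.rfl

theorem spider_isTree {n : ℕ} (hn : 0 < n) (S : Set ℕ) : (spider n S).IsTree := by
  have hr : ∀ k (hk : k < n), (spider n S).Reachable ⟨k, hk⟩ ⟨0, hn⟩ := by
    intro k
    induction k using Nat.strong_induction_on with | _ k ih
    intro hk
    rcases Nat.eq_zero_or_pos k with rfl | h
    · exact Reachable.rfl
    · have hlt := spiderParent_lt S h.ne'
      have : (spider n S).Adj ⟨k, hk⟩ ⟨spiderParent S k, hlt.trans hk⟩ :=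
        spider_adj.2 ⟨fun e => hlt.ne (congrArg Fin.val e).symm, Or.inl rfl⟩
      exact this.reachable.trans (ih _ hlt _)
  have hc : (spider n S).Connected := by
    have : Nonempty (Fin n) := ⟨⟨0, hn⟩⟩
    exact ⟨fun a b => (hr a a.2).trans (hr b b.2).symm⟩
  -- Every edge joins a nonzero vertex to its parent, so there are at most `n - 1` edges. The `% n`
  -- below only makes the parent an element of `Fin n`.
  refine isTree_iff_connected_and_card.2 ⟨hc, le_antisymm ?_ hc.card_vert_le_card_edgeSet_add_one⟩
  have hsub : (spider n S).edgeSet ⊆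
      (fun v : Fin n => s(v, ⟨spiderParent S v % n, Nat.mod_lt _ hn⟩)) '' {⟨0, hn⟩}ᶜ := by
    have key : ∀ a b : Fin n, a ≠ b → spiderParent S a = b → s(a, b) ∈
        (fun v : Fin n => s(v, ⟨spiderParent S v % n, Nat.mod_lt _ hn⟩)) '' {⟨0, hn⟩}ᶜ := by
      intro a b hne h
      refine ⟨a, ?_, ?_⟩
      · rintro rfl
        have : spiderParent S 0 = 0 := by unfold spiderParent; split_ifs <;> rfl
        exact hne (Fin.ext (this.symm.trans h))
      · simp only [h, Nat.mod_eq_of_lt b.2]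
    intro e
    induction e with | _ a b
    rintro ⟨hne, h | h⟩
    · exact key a b hne h
    · rw [Sym2.eq_swap]
      exact key b a hne.symm h
  have h1 := (Set.ncard_le_ncard hsub (Set.toFinite _)).trans (Set.ncard_image_le (Set.toFinite _))
  have h2 := Set.ncard_add_ncard_compl ({⟨0, hn⟩} : Set (Fin n))
  rw [Set.ncard_singleton, Nat.card_fin] at h2
  rw [Nat.card_coe_set_eq, Nat.card_fin]
  omega

theorem spider_adj_iff_of_ne_zero {n : ℕ} {S : Set ℕ} {v u : Fin n}
    (hv : (v : ℕ) ≠ 0) :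
    (spider n S).Adj v u ↔
      (u : ℕ) = spiderParent S v ∨ ((u : ℕ) = v + 1 ∧ (v : ℕ) + 1 ∈ S) := by
  have hlt := spiderParent_lt S hv
  rw [spider_adj]
  constructor
  · rintro ⟨hne, h | h⟩
    · exact Or.inl h.symm
    · by_cases hu : (u : ℕ) ∈ S
      · rw [spiderParent_of_mem hu] at h
        have : (u : ℕ) = v + 1 := by omega
        exact Or.inr ⟨this, this ▸ hu⟩
      · rw [spiderParent_of_notMem hu] at h
        omega
  · rintro (h | ⟨h, hS⟩)
    · exact ⟨fun e => by rw [e] at h hlt; omega, Or.inl h.symm⟩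
    · refine ⟨fun e => by rw [e] at h; omega, Or.inr ?_⟩
      rw [h, spiderParent_of_mem hS]
      omega

/-- The vertex `1` would hang from `0` even as a member of `S`, since `1 - 1 = 0`; `h1` excludes
this exception. -/
theorem spider_adj_zero_iff {n : ℕ} {S : Set ℕ} (h1 : 1 ∉ S) {v u : Fin n} (hv : (v : ℕ) = 0) :
    (spider n S).Adj v u ↔ (u : ℕ) ≠ 0 ∧ (u : ℕ) ∉ S := by
  have h0 : spiderParent S 0 = 0 := by unfold spiderParent; split_ifs <;> rfl
  rw [spider_adj, hv, h0, ne_eq, Fin.ext_iff, hv]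
  constructor
  · rintro ⟨hne, h | h⟩
    · exact absurd h hne
    · refine ⟨fun e => hne e.symm, fun hS => ?_⟩
      rw [spiderParent_of_mem hS] at h
      have : (u : ℕ) = 1 := by omega
      exact h1 (this ▸ hS)
  · rintro ⟨hne, hS⟩
    exact ⟨fun e => hne e.symm, Or.inr (spiderParent_of_notMem hS)⟩

open Classical in
theorem spider_lapMatrix_mulVec {R : Type*} [CommRing R] {n : ℕ} {S : Set ℕ}
    [DecidableRel (spider n S).Adj] (ζ : ℕ → R) (v : Fin n) (hv : (v : ℕ) ≠ 0) :
    ((spider n S).lapMatrix R).mulVec (fun u => ζ u) v = (ζ v - ζ (spiderParent S v)) +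
      if (v : ℕ) + 1 ∈ S ∧ (v : ℕ) + 1 < n then ζ v - ζ (v + 1) else 0 := by
  have hlt := spiderParent_lt S hv
  have hp : ζ v - ζ (spiderParent S v) =
      ∑ u : Fin n, if u = ⟨spiderParent S v, hlt.trans v.2⟩ then ζ v - ζ u else 0 := by
    simp
  have hs : (if (v : ℕ) + 1 ∈ S ∧ (v : ℕ) + 1 < n then ζ v - ζ (v + 1) else 0) =
      ∑ u : Fin n, if (u : ℕ) = v + 1 ∧ (v : ℕ) + 1 ∈ S then ζ v - ζ u else 0 := by
    by_cases h : (v : ℕ) + 1 < n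
    · rw [Finset.sum_eq_single ⟨v + 1, h⟩]
      · simp [h]
      · intro u _ hu
        rw [if_neg]
        rintro ⟨h', -⟩
        exact hu (Fin.ext h')
      · simp
    · rw [if_neg (fun h' => h h'.2), Finset.sum_eq_zero]
      intro u _
      rw [if_neg]
      rintro ⟨h', -⟩
      omega
  rw [lapMatrix_mulVec_eq_sum, hp, hs, ← Finset.sum_add_distrib]
  refine Finset.sum_congr rfl fun u _ => ?_
  simp only [spider_adj_iff_of_ne_zero hv, Fin.ext_iff]
  by_cases h1 : (u : ℕ) = spiderParent S v
  · have h2 : ¬ ((u : ℕ) = v + 1) := by omega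
    simp [h1, show ¬ (spiderParent S v = v + 1) by omega]
  · simp [h1]

/-! ### Twin legs and the antisymmetric vector -/

/-- `spider n S` has two pendant paths with `m` vertices at the vertex `0`, one from `α` to
`α + m - 1`, the other from `β` to `β + m - 1`. -/
structure IsTwinLegs (n : ℕ) (S : Set ℕ) (α β m : ℕ) : Prop where
  pos : 0 < m
  left_pos : 0 < α
  le : α + m ≤ β
  right_le : β + m ≤ n
  left_mem : ∀ k ≤ m, α + k ∈ S ↔ 0 < k ∧ k < m
  right_mem : ∀ k ≤ m, β + k ∈ S ↔ 0 < k ∧ k < m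

/-- The function that is `pathPoly` along the first leg and its negative along the second. -/
noncomputable def legVector (α β m v : ℕ) : ℝ[X] :=
  if α ≤ v ∧ v < α + m then pathPoly (v - α + 1)
  else if β ≤ v ∧ v < β + m then -pathPoly (v - β + 1) else 0

namespace IsTwinLegs

variable {n : ℕ} {S : Set ℕ} {α β m : ℕ}

theorem legVector_left {k : ℕ} (hk : k < m) :
    legVector α β m (α + k) = pathPoly (k + 1) := by
  rw [legVector, if_pos (by omega), Nat.add_sub_cancel_left]

theorem legVector_right (h : IsTwinLegs n S α β m) {k : ℕ} (hk : k < m) :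
    legVector α β m (β + k) = -pathPoly (k + 1) := by
  have := h.le
  rw [legVector, if_neg (by omega), if_pos (by omega), Nat.add_sub_cancel_left]

theorem legVector_other {v : ℕ} (hα : ¬ (α ≤ v ∧ v < α + m)) (hβ : ¬ (β ≤ v ∧ v < β + m)) :
    legVector α β m v = 0 := by
  rw [legVector, if_neg hα, if_neg hβ]

theorem legVector_zero (h : IsTwinLegs n S α β m) : legVector α β m 0 = 0 := by
  have := h.le
  have := h.left_pos
  exact legVector_other (by omega) (by omega)

-- Along a leg the equation is the recursion of `pathPoly`. Only the last vertex, which has no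
-- successor, leaves a defect. The factor `c` serves both legs, with `1` and `-1`.
open Classical in
theorem leg_equation (γ : ℕ) (hm : 0 < m) (hn : γ + m ≤ n)
    (hmem : ∀ k ≤ m, γ + k ∈ S ↔ 0 < k ∧ k < m) (ζ : ℕ → ℝ[X]) (c : ℝ[X]) (h0 : ζ 0 = 0)
    (hζ : ∀ k < m, ζ (γ + k) = c * pathPoly (k + 1)) {k : ℕ} (hk : k < m) :
    X * ζ (γ + k) - ((ζ (γ + k) - ζ (spiderParent S (γ + k))) +
      if (γ + k) + 1 ∈ S ∧ (γ + k) + 1 < n then ζ (γ + k) - ζ (γ + k + 1) else 0) =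
      if k + 1 = m then c * (pathPoly m - pathPoly (m + 1)) else 0 := by
  have hrec : pathPoly (k + 2) = (C 2 - X) * pathPoly (k + 1) - pathPoly k := rfl
  have hC : (C 2 : ℝ[X]) = 2 := map_ofNat C 2
  have hp : ζ (spiderParent S (γ + k)) = c * pathPoly k := by
    cases k with
    | zero =>
      rw [spiderParent_of_notMem (fun h => by have := (hmem 0 (by omega)).1 h; omega), h0]
      simp [pathPoly]
    | succ j =>
      rw [spiderParent_of_mem ((hmem (j + 1) hk.le).2 ⟨by omega, hk⟩)]
      exact hζ j (by omega)
  rw [hp, hζ k hk]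
  by_cases hkm : k + 1 = m
  · rw [if_neg (fun h => by have := (hmem (k + 1) (by omega)).1 h.1; omega), if_pos hkm, ← hkm,
      hrec, hC]
    ring
  · rw [if_pos ⟨(hmem (k + 1) (by omega)).2 (by omega), by omega⟩, if_neg hkm,
      show γ + k + 1 = γ + (k + 1) from rfl, hζ (k + 1) (by omega), hrec, hC]
    ring

/-- This provides the solution needed by `mul_charpoly_lapMatrix_sup_edge`: the defects at the two
leg ends are opposite. -/
theorem legVector_equation (h : IsTwinLegs n S α β m) (h1 : 1 ∉ S)
    [DecidableRel (spider n S).Adj] (v : Fin n) :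
    X * legVector α β m v -
      ((spider n S).lapMatrix ℝ[X]).mulVec (fun u => legVector α β m u) v =
      (pathPoly m - pathPoly (m + 1)) *
        ((if (v : ℕ) = α + m - 1 then 1 else 0) - if (v : ℕ) = β + m - 1 then 1 else 0) := by
  classical
  obtain ⟨hm, hα, hαβ, hβ, hαS, hβS⟩ := id h
  by_cases hv : (v : ℕ) = 0
  · have hz := h.legVector_zero
    rw [lapMatrix_mulVec_eq_sum, hv, hz, if_neg (by omega), if_neg (by omega)]
    have hab : (⟨α, by omega⟩ : Fin n) ≠ ⟨β, by omega⟩ := by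
      rw [ne_eq, Fin.ext_iff]
      dsimp only
      omega
    -- At the centre only the first vertices of the two legs contribute, and their opposite values
    -- cancel.
    rw [Finset.sum_eq_add (⟨α, by omega⟩ : Fin n) ⟨β, by omega⟩ hab]
    · have ha := hαS 0 hm.le
      have hb := hβS 0 hm.le
      have hla := legVector_left (α := α) (β := β) hm
      have hlb := h.legVector_right hm
      simp only [Nat.add_zero, lt_irrefl, false_and, iff_false] at ha hb hla hlb
      rw [if_pos ((spider_adj_zero_iff h1 hv).2 ⟨hα.ne', ha⟩),
        if_pos ((spider_adj_zero_iff h1 hv).2 ⟨by dsimp only; omega, hb⟩), hla, hlb]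
      ring
    · intro u _ hu
      by_cases hadj : (spider n S).Adj v u
      · rw [if_pos hadj, legVector_other, sub_zero]
        · rintro ⟨h2, h3⟩
          obtain ⟨k, hk⟩ := Nat.exists_eq_add_of_le h2
          refine ((spider_adj_zero_iff h1 hv).1 hadj).2 ?_
          rw [hk]
          refine (hαS k (by omega)).2 ⟨Nat.pos_of_ne_zero ?_, by omega⟩
          rintro rfl
          exact hu.1 (Fin.ext hk)
        · rintro ⟨h2, h3⟩
          obtain ⟨k, hk⟩ := Nat.exists_eq_add_of_le h2
          refine ((spider_adj_zero_iff h1 hv).1 hadj).2 ?_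
          rw [hk]
          refine (hβS k (by omega)).2 ⟨Nat.pos_of_ne_zero ?_, by omega⟩
          rintro rfl
          exact hu.2 (Fin.ext hk)
      · rw [if_neg hadj]
    · simp
    · simp
  · rw [spider_lapMatrix_mulVec _ v hv]
    by_cases hvα : α ≤ (v : ℕ) ∧ (v : ℕ) < α + m
    · obtain ⟨k, hk⟩ := Nat.exists_eq_add_of_le hvα.1
      rw [hk, leg_equation α hm (by omega) hαS _ 1 h.legVector_zero
        (fun j hj => by rw [legVector_left hj, one_mul]) (by omega), one_mul,
        if_neg (show ¬ (α + k = β + m - 1) by omega)]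
      by_cases hkm : k + 1 = m
      · rw [if_pos hkm, if_pos (by omega)]
        ring
      · rw [if_neg hkm, if_neg (by omega)]
        ring
    by_cases hvβ : β ≤ (v : ℕ) ∧ (v : ℕ) < β + m
    · obtain ⟨k, hk⟩ := Nat.exists_eq_add_of_le hvβ.1
      rw [hk, leg_equation β hm hβ hβS _ (-1) h.legVector_zero
        (fun j hj => by rw [h.legVector_right hj, neg_one_mul]) (by omega),
        if_neg (show ¬ (β + k = α + m - 1) by omega)]
      by_cases hkm : k + 1 = m
      · rw [if_pos hkm, if_pos (by omega)]
        ring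
      · rw [if_neg hkm, if_neg (by omega)]
        ring
    · have hp : legVector α β m (spiderParent S v) = 0 := by
        by_cases hvS : (v : ℕ) ∈ S
        · rw [spiderParent_of_mem hvS]
          refine legVector_other (fun h2 => ?_) (fun h2 => ?_)
          · have : (v : ℕ) = α + m := by omega
            exact absurd ((hαS m le_rfl).1 (this ▸ hvS)) (by omega)
          · have : (v : ℕ) = β + m := by omega
            exact absurd ((hβS m le_rfl).1 (this ▸ hvS)) (by omega)
        · rw [spiderParent_of_notMem hvS, h.legVector_zero]
      have hs : (v : ℕ) + 1 ∈ S → legVector α β m (v + 1) = 0 := by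
        intro hS
        refine legVector_other (fun h2 => ?_) (fun h2 => ?_)
        · have : (v : ℕ) + 1 = α + 0 := by omega
          exact absurd ((hαS 0 hm.le).1 (this ▸ hS)) (by omega)
        · have : (v : ℕ) + 1 = β + 0 := by omega
          exact absurd ((hβS 0 hm.le).1 (this ▸ hS)) (by omega)
      rw [hp, legVector_other hvα hvβ, if_neg (show ¬ ((v : ℕ) = α + m - 1) by omega),
        if_neg (show ¬ ((v : ℕ) = β + m - 1) by omega)]
      split_ifs with hS
      · rw [hs hS.1]
        ring
      · ring

end IsTwinLegs

/-! ### Joining the ends of twin legs: spectrum, energy and degrees -/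

theorem charpoly_lapMatrix_eq_prod {V : Type*} [Fintype V] [DecidableEq V] (G : SimpleGraph V)
    [DecidableRel G.Adj] :
    (G.lapMatrix ℝ).charpoly = (G.lapSpectrum.map fun μ => X - C μ).prod := by
  have h : G.lapSpectrum = (G.lapMatrix ℝ).charpoly.roots := by
    unfold lapSpectrum
    congr!
  have hc := G.card_lapSpectrum
  rw [h] at hc ⊢
  refine (prod_multiset_X_sub_C_of_monic_of_roots_card_eq (Matrix.charpoly_monic _) ?_).symm
  rw [hc, Matrix.charpoly_natDegree_eq_dim]

theorem IsTree.avgDegree_sup_edge {V : Type*} [Fintype V] [DecidableEq V] {T : SimpleGraph V}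
    (hT : T.IsTree) {a b : V} (hne : a ≠ b) (hab : ¬ T.Adj a b) :
    (T ⊔ edge a b).avgDegree = 2 := by
  classical
  have hcard := T.card_edgeFinset_sup_edge hab hne
  rw [hT.card_edgeFinset] at hcard
  have h : ∑ v, (T ⊔ edge a b).degree v = 2 * Fintype.card V := by
    refine (T ⊔ edge a b).sum_degrees_eq_twice_card_edges.trans (congrArg _ ?_)
    convert! hcard
  have hpos : (Fintype.card V : ℝ) ≠ 0 := by
    have : Nonempty V := ⟨a⟩
    exact_mod_cast Fintype.card_ne_zero
  have h' : ∑ v, ((T ⊔ edge a b).degree v : ℝ) = 2 * Fintype.card V := by exact_mod_cast h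
  unfold avgDegree
  rw [div_eq_iff hpos, ← h']
  congr!

namespace IsTwinLegs

variable {n : ℕ} {S : Set ℕ} {α β m : ℕ}

/-- The last vertex of the first leg. -/
def leftEnd (h : IsTwinLegs n S α β m) : Fin n :=
  ⟨α + m - 1, by have := h.pos; have := h.le; have := h.right_le; omega⟩

/-- The last vertex of the second leg. -/
def rightEnd (h : IsTwinLegs n S α β m) : Fin n :=
  ⟨β + m - 1, by have := h.pos; have := h.right_le; omega⟩

/-- The graph obtained from `spider n S` by joining the ends of the two legs. -/
def closure (h : IsTwinLegs n S α β m) : SimpleGraph (Fin n) :=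
  spider n S ⊔ edge h.leftEnd h.rightEnd

theorem leftEnd_ne_rightEnd (h : IsTwinLegs n S α β m) : h.leftEnd ≠ h.rightEnd := by
  have := h.pos
  have := h.le
  rw [ne_eq, Fin.ext_iff]
  dsimp only [leftEnd, rightEnd]
  omega

theorem leftEnd_val_ne_zero (h : IsTwinLegs n S α β m) : (h.leftEnd : ℕ) ≠ 0 := by
  have := h.pos
  have := h.left_pos
  dsimp only [leftEnd]
  omega

theorem rightEnd_val_ne_zero (h : IsTwinLegs n S α β m) : (h.rightEnd : ℕ) ≠ 0 := by
  have := h.pos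
  have := h.le
  dsimp only [rightEnd]
  omega

theorem not_adj_ends (h : IsTwinLegs n S α β m) :
    ¬ (spider n S).Adj h.leftEnd h.rightEnd := by
  have := h.pos
  have := h.le
  rw [spider_adj_iff_of_ne_zero h.leftEnd_val_ne_zero]
  have hlt := spiderParent_lt S h.leftEnd_val_ne_zero
  dsimp only [leftEnd, rightEnd] at hlt ⊢
  rintro (h1 | ⟨-, h2⟩)
  · omega
  · rw [show α + m - 1 + 1 = α + m by omega] at h2
    exact absurd ((h.left_mem m le_rfl).1 h2) (by omega)

theorem size_pos (h : IsTwinLegs n S α β m) : 0 < n := h.leftEnd.pos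

theorem isUnicyclic_closure (h : IsTwinLegs n S α β m) : h.closure.IsUnicyclic :=
  (spider_isTree h.size_pos S).isUnicyclic_sup_edge h.leftEnd_ne_rightEnd h.not_adj_ends

/-- With `d = pathPoly m - pathPoly (m + 1)`, the values of the leg vector at the two ends differ by
`2 * pathPoly m`, so the factor `d - (z a - z b)` is `-(pathPoly (m + 1) + pathPoly m)`. -/
theorem charpoly_closure (h : IsTwinLegs n S α β m) (h1 : 1 ∉ S)
    [DecidableRel (spider n S).Adj] [DecidableRel h.closure.Adj] :
    (pathPoly (m + 1) - pathPoly m) * (h.closure.lapMatrix ℝ).charpoly =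
      ((spider n S).lapMatrix ℝ).charpoly * (pathPoly (m + 1) + pathPoly m) := by
  have hm := h.pos
  let : DecidableRel (spider n S ⊔ edge h.leftEnd h.rightEnd).Adj :=
    ‹DecidableRel h.closure.Adj›
  have key := mul_charpoly_lapMatrix_sup_edge (spider n S) h.leftEnd_ne_rightEnd h.not_adj_ends
    (fun u => legVector α β m u) (pathPoly m - pathPoly (m + 1)) (fun v => by
      rw [h.legVector_equation h1 v]
      simp only [Fin.ext_iff, leftEnd, rightEnd])
  have hl : legVector α β m h.leftEnd = pathPoly m := by
    have := legVector_left (α := α) (β := β) (show m - 1 < m by omega)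
    rwa [show α + (m - 1) = α + m - 1 by omega, show m - 1 + 1 = m by omega] at this
  have hr : legVector α β m h.rightEnd = -pathPoly m := by
    have := h.legVector_right (show m - 1 < m by omega)
    rwa [show β + (m - 1) = β + m - 1 by omega, show m - 1 + 1 = m by omega] at this
  rw [hl, hr] at key
  have hG : (h.closure.lapMatrix ℝ).charpoly =
      ((spider n S ⊔ edge h.leftEnd h.rightEnd).lapMatrix ℝ).charpoly := rfl
  rw [hG]
  linear_combination -key

open Classical in
theorem laplacianEnergy_closure (h : IsTwinLegs n S α β m) (h1 : 1 ∉ S) :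
    h.closure.laplacianEnergy =
      (((spider n S).lapMatrix ℝ).charpoly.roots.map fun μ => |μ - 2|).sum := by
  have hcp := h.charpoly_closure h1
  have hne : ∀ G : SimpleGraph (Fin n), (G.lapMatrix ℝ).charpoly ≠ 0 :=
    fun G => (Matrix.charpoly_monic _).ne_zero
  have hr := congrArg (fun p : ℝ[X] => (p.roots.map fun μ => |μ - 2|).sum) hcp
  rw [roots_mul (mul_ne_zero (pathPoly_succ_sub_ne_zero m) (hne _)),
    roots_mul (mul_ne_zero (hne _) (pathPoly_succ_add_ne_zero m)), Multiset.map_add,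
    Multiset.map_add, Multiset.sum_add, Multiset.sum_add, pathPoly_sum_abs] at hr
  have hd : h.closure.avgDegree = 2 := (spider_isTree h.size_pos S).avgDegree_sup_edge
    h.leftEnd_ne_rightEnd h.not_adj_ends
  rw [laplacianEnergy, hd, lapSpectrum]
  linarith

/-- Equal spectra would make the quotients of the plus and minus polynomials equal for `m` and `m'`,
but at 0 these are `2 * m + 1` and `2 * m' + 1`. -/
theorem lapSpectrum_closure_ne (h : IsTwinLegs n S α β m) {α' β' m' : ℕ}
    (h' : IsTwinLegs n S α' β' m') (h1 : 1 ∉ S) (hm : m ≠ m') :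
    h.closure.lapSpectrum ≠ h'.closure.lapSpectrum := by
  classical
  intro heq
  have hG : (h.closure.lapMatrix ℝ).charpoly = (h'.closure.lapMatrix ℝ).charpoly := by
    rw [charpoly_lapMatrix_eq_prod, charpoly_lapMatrix_eq_prod, heq]
  have e := h.charpoly_closure h1
  have e' := h'.charpoly_closure h1
  rw [← hG] at e'
  have hT : ((spider n S).lapMatrix ℝ).charpoly ≠ 0 := (Matrix.charpoly_monic _).ne_zero
  have key : (pathPoly (m + 1) + pathPoly m) * (pathPoly (m' + 1) - pathPoly m') =
      (pathPoly (m' + 1) + pathPoly m') * (pathPoly (m + 1) - pathPoly m) := by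
    refine mul_left_cancel₀ hT ?_
    linear_combination (pathPoly (m + 1) - pathPoly m) * e' -
      (pathPoly (m' + 1) - pathPoly m') * e
  have := congrArg (eval 0) key
  rw [eval_mul, eval_mul, pathPoly_succ_add_eval_zero, pathPoly_succ_add_eval_zero,
    pathPoly_succ_sub_eval_zero, pathPoly_succ_sub_eval_zero] at this
  exact hm (by exact_mod_cast (by linarith : (m : ℝ) = m'))

theorem closure_adj_zero_iff (h : IsTwinLegs n S α β m) (h1 : 1 ∉ S) {v u : Fin n}
    (hv : (v : ℕ) = 0) : h.closure.Adj v u ↔ (u : ℕ) ≠ 0 ∧ (u : ℕ) ∉ S := by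
  rw [closure, sup_adj, spider_adj_zero_iff h1 hv, or_iff_left]
  rw [edge_adj]
  rintro ⟨⟨rfl, -⟩ | ⟨rfl, -⟩, -⟩
  · exact h.leftEnd_val_ne_zero hv
  · exact h.rightEnd_val_ne_zero hv

theorem ncard_neighborSet_closure_le (h : IsTwinLegs n S α β m) {v : Fin n} (hv : (v : ℕ) ≠ 0) :
    (h.closure.neighborSet v).ncard ≤ 3 := by
  classical
  rw [← Set.ncard_image_of_injective _ Fin.val_injective]
  -- The candidates are the parent, the next vertex on a leg, and the other end of the new edge; the
  -- third is a dummy unless `v` is an end.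
  have hsub : Fin.val '' h.closure.neighborSet v ⊆ (({spiderParent S v, (v : ℕ) + 1,
      if v = h.leftEnd then (h.rightEnd : ℕ) else h.leftEnd} : Finset ℕ) : Set ℕ) := by
    rintro _ ⟨u, hu, rfl⟩
    simp only [Finset.coe_insert, Finset.coe_singleton, Set.mem_insert_iff, Set.mem_singleton_iff]
    rw [mem_neighborSet, closure, sup_adj, spider_adj_iff_of_ne_zero hv, edge_adj] at hu
    rcases hu with (hu | hu) | ⟨⟨hu, hu'⟩ | ⟨hu, hu'⟩, -⟩
    · exact Or.inl hu
    · exact Or.inr (Or.inl hu.1)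
    · rw [if_pos hu, hu']
      exact Or.inr (Or.inr rfl)
    · rw [if_neg (fun e => h.leftEnd_ne_rightEnd (e.symm.trans hu)), hu']
      exact Or.inr (Or.inr rfl)
  refine (Set.ncard_le_ncard hsub (Finset.finite_toSet _)).trans ?_
  rw [Set.ncard_coe_finset]
  exact Finset.card_le_three

/-- If `0` has degree at least `4` in `spider n S` and a smaller degree in `spider n S'`, closing
legs in the two trees leads to nonisomorphic graphs. -/
theorem isEmpty_iso_closure (h : IsTwinLegs n S α β m) {S' : Set ℕ} {α' β' m' : ℕ}
    (h' : IsTwinLegs n S' α' β' m') (h1 : 1 ∉ S') (hSS : S ⊆ S')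
    (hlt : ∃ v < n, v ≠ 0 ∧ v ∉ S ∧ v ∈ S')
    (h4 : ∃ s : Finset ℕ, s.card = 4 ∧ ∀ v ∈ s, v < n ∧ v ≠ 0 ∧ v ∉ S) :
    IsEmpty (h.closure ≃g h'.closure) := by
  refine ⟨fun φ => ?_⟩
  have h1S : 1 ∉ S := fun e => h1 (hSS e)
  let o : Fin n := ⟨0, h.size_pos⟩
  have hφ : (h.closure.neighborSet o).ncard = (h'.closure.neighborSet (φ o)).ncard := by
    rw [← Nat.card_coe_set_eq, ← Nat.card_coe_set_eq]
    exact Nat.card_congr (φ.mapNeighborSet o)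
  -- If the centre goes to the centre, the degrees differ; otherwise its image has degree at most 3,
  -- while the centre has degree at least 4.
  by_cases ho : ((φ o : Fin n) : ℕ) = 0
  · refine absurd hφ (ne_of_gt (Set.ncard_lt_ncard ?_ (Set.toFinite _)))
    obtain ⟨v, hvn, hv0, hvS, hvS'⟩ := hlt
    rw [Set.ssubset_iff_of_subset]
    · refine ⟨⟨v, hvn⟩, (h.closure_adj_zero_iff h1S rfl).2 ⟨hv0, hvS⟩, fun hv => ?_⟩
      exact ((h'.closure_adj_zero_iff h1 ho).1 hv).2 hvS'
    · intro u hu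
      have := (h'.closure_adj_zero_iff h1 ho).1 hu
      exact (h.closure_adj_zero_iff h1S rfl).2 ⟨this.1, fun e => this.2 (hSS e)⟩
  · have h3 := h'.ncard_neighborSet_closure_le ho
    obtain ⟨s, hs, hsS⟩ := h4
    have hsub : (s : Set ℕ) ⊆ Fin.val '' h.closure.neighborSet o := by
      intro v hv
      obtain ⟨hvn, hv⟩ := hsS v hv
      exact ⟨⟨v, hvn⟩, (h.closure_adj_zero_iff h1S rfl).2 hv, rfl⟩
    have := Set.ncard_le_ncard hsub (Set.toFinite _)
    rw [Set.ncard_coe_finset, Set.ncard_image_of_injective _ Fin.val_injective] at this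
    omega

end IsTwinLegs

/-! ### The concrete spiders and the two families -/

/-- The vertices of a spider that are not attached to `0`, for `2ℓ` legs of lengths
`1, 1, 2, 2, …, ℓ, ℓ` starting at the vertices `1 + ℓ * j` for `j < 2ℓ`, and those in the additional
set `E`. -/
def legSet (ℓ : ℕ) (E : Set ℕ) : Set ℕ :=
  {v | ∃ j k, j < 2 * ℓ ∧ 0 < k ∧ k ≤ j / 2 ∧ v = 1 + ℓ * j + k} ∪ E

theorem leg_bound {ℓ j k : ℕ} (hj : j < 2 * ℓ) (hk : k ≤ ℓ) :
    1 + ℓ * j + k ≤ 2 * ℓ ^ 2 + 1 := by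
  have : ℓ * (j + 1) ≤ ℓ * (2 * ℓ) := Nat.mul_le_mul_left _ hj
  nlinarith

/-- Leg `j` has `j / 2 + 1 ≤ ℓ` vertices and stays inside its block of length `ℓ`. The case `k = j /
2 + 1`, just past the leg, may fall on `2 * ℓ ^ 2 + 1`, whence the strict bound in `hE`. -/
theorem mem_legSet_iff {ℓ : ℕ} {E : Set ℕ} (hE : ∀ e ∈ E, 2 * ℓ ^ 2 + 1 < e) {j k : ℕ}
    (hj : j < 2 * ℓ) (hk : k ≤ j / 2 + 1) :
    1 + ℓ * j + k ∈ legSet ℓ E ↔ 0 < k ∧ k < j / 2 + 1 := by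
  constructor
  · rintro (⟨j', k', hj', hk0, hk', h⟩ | h)
    · rcases lt_trichotomy j' j with hlt | rfl | hlt
      · have : ℓ * (j' + 1) ≤ ℓ * j := Nat.mul_le_mul_left _ hlt
        rw [mul_add_one] at this
        omega
      · omega
      · have : ℓ * (j + 1) ≤ ℓ * j' := Nat.mul_le_mul_left _ hlt
        rw [mul_add_one] at this
        omega
    · have := hE _ h
      have := leg_bound hj (show k ≤ ℓ by omega)
      omega
  · rintro ⟨h0, h1⟩
    exact Or.inl ⟨j, k, hj, h0, by omega, rfl⟩

theorem one_notMem_legSet {ℓ : ℕ} {E : Set ℕ} (hℓ : 0 < ℓ) (hE : ∀ e ∈ E, 2 * ℓ ^ 2 + 1 < e) :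
    1 ∉ legSet ℓ E := fun h => by
  have := (mem_legSet_iff hE (show 0 < 2 * ℓ by omega) (show 0 ≤ 0 / 2 + 1 by omega)).1 h
  omega

theorem isTwinLegs_legSet {ℓ n : ℕ} {E : Set ℕ} (hE : ∀ e ∈ E, 2 * ℓ ^ 2 + 1 < e)
    (hn : 2 * ℓ ^ 2 + 1 ≤ n) (i : Fin ℓ) :
    IsTwinLegs n (legSet ℓ E) (1 + ℓ * (2 * i)) (1 + ℓ * (2 * i + 1)) (i + 1) where
  pos := Nat.succ_pos _
  left_pos := by omega
  le := by
    have := i.2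
    rw [mul_add_one]
    omega
  right_le := (leg_bound (by omega) i.2).trans hn
  left_mem k hk := by
    rw [mem_legSet_iff hE (by omega) (by omega)]
    omega
  right_mem k hk := by
    rw [mem_legSet_iff hE (by omega) (by omega)]
    omega

theorem isEquienergeticUnicyclicFamily_closure {ℓ n : ℕ} {E : Set ℕ}
    (hE : ∀ e ∈ E, 2 * ℓ ^ 2 + 1 < e) (hn : 2 * ℓ ^ 2 + 1 ≤ n) :
    IsEquienergeticUnicyclicFamily fun i : Fin ℓ => (isTwinLegs_legSet hE hn i).closure := by
  have h1 : ∀ i : Fin ℓ, 1 ∉ legSet ℓ E := fun i => one_notMem_legSet i.pos hE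
  refine ⟨fun i => IsTwinLegs.isUnicyclic_closure _, fun i j hij => ?_, fun i j => ?_⟩
  · exact IsTwinLegs.lapSpectrum_closure_ne _ _ (h1 i) fun e =>
      hij (Fin.ext (Nat.succ_injective e))
  · rw [IsTwinLegs.laplacianEnergy_closure _ (h1 i), IsTwinLegs.laplacianEnergy_closure _ (h1 i)]

end SimpleGraph

open SimpleGraph

theorem exists_isEquienergeticUnicyclicFamily {ℓ n : ℕ} (hn : 2 * ℓ ^ 2 + 1 ≤ n) :
    ∃ G : Fin ℓ → SimpleGraph (Fin n), IsEquienergeticUnicyclicFamily G :=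
  ⟨_, isEquienergeticUnicyclicFamily_closure (E := ∅) (by simp) hn⟩

/-- Taking `E = {n - 1}` rehangs the leaf `n - 1` from `n - 2`, which lies beyond all leg blocks and
is itself a leaf at the centre in the first spider. -/
theorem exists_two_isEquienergeticUnicyclicFamily {ℓ n : ℕ} (hℓ : 2 ≤ ℓ)
    (hn : 2 * ℓ ^ 2 + 3 ≤ n) :
    ∃ G G' : Fin ℓ → SimpleGraph (Fin n),
      IsEquienergeticUnicyclicFamily G ∧ IsEquienergeticUnicyclicFamily G' ∧
      ∀ i j, IsEmpty (G i ≃g G' j) := by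
  have hE : ∀ e ∈ (∅ : Set ℕ), 2 * ℓ ^ 2 + 1 < e := by simp
  have hE' : ∀ e ∈ ({n - 1} : Set ℕ), 2 * ℓ ^ 2 + 1 < e := by
    rintro e rfl
    omega
  refine ⟨_, _, isEquienergeticUnicyclicFamily_closure hE (by omega),
    isEquienergeticUnicyclicFamily_closure hE' (by omega), fun i j => ?_⟩
  refine IsTwinLegs.isEmpty_iso_closure _ _ (one_notMem_legSet (by omega) hE')
    (Set.union_subset_union_right _ (Set.empty_subset _))
    ⟨n - 1, by omega, by omega, ?_, Or.inr rfl⟩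
    -- The first vertices of four legs are neighbours of the centre; `2 ≤ ℓ` ensures that there are
    -- four legs.
    ⟨(Finset.range 4).image fun j => 1 + ℓ * j, ?_, ?_⟩
  · rintro (⟨j, k, hj, hk0, hk, h⟩ | h)
    · have := leg_bound hj (show k ≤ ℓ by omega)
      omega
    · exact h
  · rw [Finset.card_image_of_injective _ fun a b h => ?_, Finset.card_range]
    simp only [add_right_inj] at h
    exact Nat.eq_of_mul_eq_mul_left (by omega) h
  · intro v hv
    obtain ⟨j, hj, rfl⟩ := Finset.mem_image.1 hv
    rw [Finset.mem_range] at hj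
    have := leg_bound (show j < 2 * ℓ by omega) (Nat.zero_le ℓ)
    refine ⟨by omega, by omega, fun h => ?_⟩
    have := (mem_legSet_iff hE (show j < 2 * ℓ by omega) (Nat.zero_le _)).1 h
    omega

theorem mainTheorem5 :
    (∀ ℓ γ : ℕ, 2 ≤ ℓ → 1 ≤ γ →
      ∃ G : Fin ℓ → SimpleGraph (Fin (2 * ℓ ^ 2 + 2 * ℓ + 2 * γ)),
        IsEquienergeticUnicyclicFamily G) ∧
    (∀ ℓ γ : ℕ, 2 ≤ ℓ → 2 ≤ γ →
      ∃ G G' : Fin ℓ → SimpleGraph (Fin (2 * ℓ ^ 2 + 2 * ℓ + 2 * γ)),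
        IsEquienergeticUnicyclicFamily G ∧ IsEquienergeticUnicyclicFamily G' ∧
        ∀ i j, IsEmpty (G i ≃g G' j)) ∧
    (∃ m : ℕ → ℕ,
      Asymptotics.IsTheta
        (Filter.atTop ⊓ Filter.principal {n : ℕ | ∃ ℓ : ℕ, 2 ≤ ℓ ∧ n = 2 * ℓ ^ 2 + 2 * ℓ + 2})
        (fun n : ℕ => (m n : ℝ)) (fun n : ℕ => Real.sqrt n) ∧
      ∀ n : ℕ, (∃ ℓ : ℕ, 2 ≤ ℓ ∧ n = 2 * ℓ ^ 2 + 2 * ℓ + 2) →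
        ∃ G : Fin (m n) → SimpleGraph (Fin n), IsEquienergeticUnicyclicFamily G) := by
  -- This recovers `ℓ` from `n`, as `n / 2 = ℓ ^ 2 + ℓ + 1` lies below `(ℓ + 1) ^ 2`.
  have hm : ∀ ℓ : ℕ, 2 ≤ ℓ → Nat.sqrt ((2 * ℓ ^ 2 + 2 * ℓ + 2) / 2) = ℓ := by
    intro ℓ hℓ
    rw [show (2 * ℓ ^ 2 + 2 * ℓ + 2) / 2 = ℓ * ℓ + (ℓ + 1) by rw [sq]; omega]
    refine (Nat.eq_sqrt.2 ⟨?_, ?_⟩).symm <;> nlinarith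
  refine ⟨fun ℓ γ _ hγ => exists_isEquienergeticUnicyclicFamily (by omega),
    fun ℓ γ hℓ hγ => exists_two_isEquienergeticUnicyclicFamily hℓ (by omega),
    fun n => Nat.sqrt (n / 2), ⟨?_, ?_⟩, ?_⟩
  · refine Asymptotics.IsBigO.of_bound 1 (Filter.eventually_inf_principal.2 (.of_forall ?_))
    rintro n ⟨ℓ, hℓ, rfl⟩
    dsimp only
    rw [hm ℓ hℓ, Real.norm_of_nonneg (Nat.cast_nonneg _), Real.norm_of_nonneg (Real.sqrt_nonneg _),
      one_mul]
    refine Real.le_sqrt_of_sq_le ?_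
    push_cast
    nlinarith [(Nat.cast_nonneg ℓ : (0 : ℝ) ≤ ℓ)]
  · refine Asymptotics.IsBigO.of_bound 3 (Filter.eventually_inf_principal.2 (.of_forall ?_))
    rintro n ⟨ℓ, hℓ, rfl⟩
    dsimp only
    rw [hm ℓ hℓ, Real.norm_of_nonneg (Nat.cast_nonneg _), Real.norm_of_nonneg (Real.sqrt_nonneg _)]
    refine Real.sqrt_le_iff.2 ⟨by positivity, ?_⟩
    have : (2 : ℝ) ≤ ℓ := by exact_mod_cast hℓ
    push_cast
    nlinarith
  · rintro n ⟨ℓ, hℓ, rfl⟩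
    dsimp only
    rw [hm ℓ hℓ]
    exact exists_isEquienergeticUnicyclicFamily (by omega)
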